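/- \textbf{Conventions.} All variable sets and formulas are finite, and $\log$ is the binary logarithm. A CNF formula on a variable set $V$ is a finite set of clauses, each a finite set of literals over $V$. A CNF formula $C$ on $X\cup Y$ ($Y$ disjoint from $X$) \emph{encodes} a Boolean function $f$ in the variables $X$ if every $a:X\to\{0,1\}$ with $f(a)=1$ has an extension to $X\cup Y$ that is a model of $C$, and no $a$ with $f(a)=0$ has such an extension. The \emph{primal graph} of $C$ has the variables as vertices, two distinct variables being adjacent iff they occur in a common clause; the \emph{dual graph} has the clauses as vertices, two distinct clauses being adjacent iff they share a variable; the \emph{incidence graph} has the variables and the clauses as vertices, $x$ being adjacent to $c$ iff $x$ occurs in $c$. The \emph{signed incidence graph} has a $+$ edge (a $-$ edge) between $x$ and $c$ iff $x$ occurs positively (negatively) in $c$. Let $\mathsf{tw_p}(C)$, $\mathsf{tw_d}(C)$, $\mathsf{tw_i}(C)$ be the treewidth of the primal, dual and incidence graph, where the treewidth of a graph is the minimum over all tree decompositions of the maximal bag size minus one, and is $0$ for the graph without vertices. Let $\mathsf{scw}(C)$ be the signed cliquewidth of the signed incidence graph, i.e. the minimum number of labels needed to construct it by the operations: create a vertex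 with label $i$; take the disjoint union of two labeled graphs; join all vertices with label $i$ to all vertices with label $j\neq i$ by $+$ edges, or by $-$ edges; rename a label $i$ to $j\ne i$ (it is $0$ for the graph without vertices). For a partition $\Pi=(Y',Z')$ of $X$, a rectangle cover of $f$ of size $s$ respecting $\Pi$ is a representation $f(X)=\bigvee_{i=1}^{s} r_1^i(Y')\wedge r_2^i(Z')$, and $\mathsf{cc}(f,\Pi)=\log(s_{\min})$ where $s_{\min}$ is the minimum size of such a cover (with $\mathsf{cc}(f,\Pi):=0$ for the constant function $f=0$). Let $\mathsf{cc}_{\mathsf{best}}^{1/3}(f)=\min_\Pi \mathsf{cc}(f,\Pi)$ over all partitions $\Pi=(Y',Z')$ of $X$ with $\min(|Y'|,|Z'|)\ge |X|/3$ (such a partition exists unless $|X|=1$, in which case we set $\mathsf{cc}_{\mathsf{best}}^{1/3}(f):=0$). \textbf{Statement.} There is a constant $b>0$ such that for every Boolean function $f$ and every CNF formula $C$ encoding $f$ we have \[\min\{\mathsf{tw_i}(C),\ \mathsf{tw_p}(C),\ \max\{1,\mathsf{tw_d}(C)\},\ \mathsf{scw}(C)\}\ \ge\ b\cdot \mathsf{cc}_{\mathsf{best}}^{1/3}(f).\]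 -/

import Mathlib

/-! ### CNF formulas and clausal encodings -/

/-- A literal over the variable set `V`: `(x, true)` is `x` and `(x, false)` is `¬ x`. -/
abbrev PLiteral (V : Type*) := V × Bool

/-- A clause is a finite set of literals, read as their disjunction. -/
abbrev PClause (V : Type*) := Finset (PLiteral V)

/-- A CNF formula on the variable set `V` is a finite set of clauses, read as their conjunction. -/
abbrev CNFFormula (V : Type*) := Finset (PClause V)

/-- The variable `x` occurs (positively or negatively) in the clause `c`. -/
def PClause.HasVar {V : Type*} (c : PClause V) (x : V) : Prop :=
  ∃ s : Bool, (x, s) ∈ c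

/-- The assignment `a` is a model of the CNF formula `F`: every clause contains a true literal. -/
def CNFFormula.IsModel {V : Type*} (F : CNFFormula V) (a : V → Bool) : Prop :=
  ∀ c ∈ F, ∃ l ∈ c, a l.1 = l.2

/-- `F` is a clausal encoding of `f`, with variables `X` and auxiliary variables `Y`. -/
def CNFFormula.IsClausalEncoding {X Y : Type*} (F : CNFFormula (X ⊕ Y))
    (f : (X → Bool) → Bool) : Prop :=
  (∀ a : X → Bool, f a = true → ∃ a' : Y → Bool, F.IsModel (Sum.elim a a')) ∧
  (∀ a : X → Bool, f a = false → ∀ a' : Y → Bool, ¬ F.IsModel (Sum.elim a a'))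

/-! ### Graphs of a CNF formula -/

/-- The primal graph: two distinct variables are adjacent iff they occur in a common clause. -/
def CNFFormula.primalGraph {V : Type*} (F : CNFFormula V) : SimpleGraph V where
  Adj x y := x ≠ y ∧ ∃ c ∈ F, PClause.HasVar c x ∧ PClause.HasVar c y
  symm := ⟨fun _ _ h => ⟨h.1.symm, h.2.imp fun _ hc => ⟨hc.1, hc.2.2, hc.2.1⟩⟩⟩
  loopless := ⟨fun _ h => h.1 rfl⟩

/-- The dual graph: two distinct clauses are adjacent iff they share a variable. -/
def CNFFormula.dualGraph {V : Type*} (F : CNFFormula V) : SimpleGraph {c // c ∈ F} where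
  Adj c d := c ≠ d ∧ ∃ x : V, PClause.HasVar c.1 x ∧ PClause.HasVar d.1 x
  symm := ⟨fun _ _ h => ⟨h.1.symm, h.2.imp fun _ hx => ⟨hx.2, hx.1⟩⟩⟩
  loopless := ⟨fun _ h => h.1 rfl⟩

/-- The bipartite graph on the disjoint union of `A` and `B` whose edges are the pairs in `r`. -/
def bipartiteOf {A B : Type*} (r : A → B → Prop) : SimpleGraph (A ⊕ B) where
  Adj
    | Sum.inl x, Sum.inr c => r x c
    | Sum.inr c, Sum.inl x => r x c
    | _, _ => False
  symm := ⟨fun u v h => by rcases u with x | c <;> rcases v with y | d <;> exact h⟩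
  loopless := ⟨fun u h => by rcases u with x | c <;> exact h⟩

/-- The incidence graph: its vertices are the variables and the clauses, and `x` is adjacent to `c`
iff `x` occurs in `c`. -/
def CNFFormula.incidenceGraph {V : Type*} (F : CNFFormula V) : SimpleGraph (V ⊕ {c // c ∈ F}) :=
  bipartiteOf fun x c => PClause.HasVar c.1 x

/-- A signed graph on `V`: `G true` holds the edges labeled `+`, `G false` those labeled `-`.
(An edge may carry both labels, which happens for a variable and a tautological clause.) -/
abbrev SignedGraph (V : Type*) := Bool → SimpleGraph V

/-- The signed incidence graph: `x` and `c` are joined by a `+` edge iff `x` appears positively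
in `c`, and by a `-` edge iff `x` appears negatively in `c`. -/
def CNFFormula.signedIncidenceGraph {V : Type*} (F : CNFFormula V) :
    SignedGraph (V ⊕ {c // c ∈ F}) :=
  fun s => bipartiteOf fun x c => (x, s) ∈ c.1

/-! ### Treewidth -/

/-- A tree decomposition of `G`, with a finite tree on the nodes `Fin size`. -/
structure TreeDecomposition {V : Type*} (G : SimpleGraph V) where
  size : ℕ
  tree : SimpleGraph (Fin size)
  isTree : tree.IsTree
  bag : Fin size → Finset V
  vertex_mem : ∀ v : V, ∃ t, v ∈ bag t
  edge_mem : ∀ u v : V, G.Adj u v → ∃ t, u ∈ bag t ∧ v ∈ bag t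
  connected : ∀ v : V, (tree.induce {t | v ∈ bag t}).Connected

/-- The maximal size of a bag, minus one. (It is `0`, not `-1`, if all bags are empty, which is
possible only for the graph without vertices.) -/
def TreeDecomposition.width {V : Type*} {G : SimpleGraph V} (D : TreeDecomposition G) : ℕ :=
  (Finset.univ.sup fun t => (D.bag t).card) - 1

/-- The treewidth of a (finite) graph: the minimum width of its tree decompositions. -/
noncomputable def SimpleGraph.treewidth {V : Type*} (G : SimpleGraph V) : ℕ :=
  sInf (Set.range fun D : TreeDecomposition G => D.width)

/-! ### Signed cliquewidth -/

/-- Construction sequences of signed graphs with vertices in `V` and labels in `Fin k`. -/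
inductive SignedExpr (V : Type*) (k : ℕ)
  /-- create the vertex `v` with label `i` -/
  | create (v : V) (i : Fin k)
  /-- disjoint union -/
  | union (e₁ e₂ : SignedExpr V k)
  /-- join all vertices with label `i` to all vertices with label `j` by edges of sign `s` -/
  | join (s : Bool) (i j : Fin k) (hij : i ≠ j) (e : SignedExpr V k)
  /-- rename the label `i` to `j` -/
  | rename (i j : Fin k) (hij : i ≠ j) (e : SignedExpr V k)

namespace SignedExpr

variable {V : Type*} {k : ℕ}

/-- The vertices of the constructed graph. -/
def verts : SignedExpr V k → Set V
  | create v _ => {v}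
  | union e₁ e₂ => e₁.verts ∪ e₂.verts
  | join _ _ _ _ e => e.verts
  | rename _ _ _ e => e.verts

/-- All unions in the expression are disjoint, i.e. every vertex is created at most once. -/
def Valid : SignedExpr V k → Prop
  | create _ _ => True
  | union e₁ e₂ => e₁.Valid ∧ e₂.Valid ∧ Disjoint e₁.verts e₂.verts
  | join _ _ _ _ e => e.Valid
  | rename _ _ _ e => e.Valid

/-- `e.HasLabel v l`: in the constructed graph, `v` is a vertex with label `l`. -/
def HasLabel : SignedExpr V k → V → Fin k → Prop
  | create v i, w, l => w = v ∧ l = i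
  | union e₁ e₂, w, l => e₁.HasLabel w l ∨ e₂.HasLabel w l
  | join _ _ _ _ e, w, l => e.HasLabel w l
  | rename i j _ e, w, l => (e.HasLabel w l ∧ l ≠ i) ∨ (e.HasLabel w i ∧ l = j)

/-- `e.Edge s u v`: in the constructed graph, `u` and `v` are joined by an edge of sign `s`. -/
def Edge : SignedExpr V k → Bool → V → V → Prop
  | create _ _, _, _, _ => False
  | union e₁ e₂, s, u, v => e₁.Edge s u v ∨ e₂.Edge s u v
  | join s' i j _ e, s, u, v => e.Edge s u v ∨
      (s = s' ∧ ((e.HasLabel u i ∧ e.HasLabel v j) ∨ (e.HasLabel u j ∧ e.HasLabel v i)))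
  | rename _ _ _ e, s, u, v => e.Edge s u v

/-- The expression `e` constructs the signed graph `G`. -/
def Constructs (e : SignedExpr V k) (G : SignedGraph V) : Prop :=
  e.Valid ∧ e.verts = Set.univ ∧ ∀ s u v, e.Edge s u v ↔ (G s).Adj u v

end SignedExpr

/-- The signed cliquewidth of a (finite) signed graph: the minimum number of labels needed to
construct it. (The graph without vertices gets the value `0`.) -/
noncomputable def SignedGraph.cliquewidth {V : Type*} (G : SignedGraph V) : ℕ :=
  sInf {k | ∃ e : SignedExpr V k, e.Constructs G}

/-! ### Width measures of CNF formulas -/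

/-- Incidence treewidth. -/
noncomputable def CNFFormula.twi {V : Type*} (F : CNFFormula V) : ℕ := F.incidenceGraph.treewidth

/-- Primal treewidth. -/
noncomputable def CNFFormula.twp {V : Type*} (F : CNFFormula V) : ℕ := F.primalGraph.treewidth

/-- Dual treewidth. -/
noncomputable def CNFFormula.twd {V : Type*} (F : CNFFormula V) : ℕ := F.dualGraph.treewidth

/-- Signed incidence cliquewidth. -/
noncomputable def CNFFormula.scw {V : Type*} (F : CNFFormula V) : ℕ :=
  SignedGraph.cliquewidth F.signedIncidenceGraph

/-! ### Communication complexity -/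

/-- `f` has a rectangle cover of size `s` respecting the partition `(Y, Yᶜ)` of its variables. -/
def HasRectangleCover {X : Type*} (f : (X → Bool) → Bool) (Y : Set X) (s : ℕ) : Prop :=
  ∃ (r₁ : Fin s → (Y → Bool) → Bool) (r₂ : Fin s → ((Yᶜ : Set X) → Bool) → Bool),
    ∀ a : X → Bool, f a = true ↔
      ∃ i, r₁ i (fun x => a x) = true ∧ r₂ i (fun x => a x) = true

/-- Nondeterministic communication complexity of `f` for the partition `(Y, Yᶜ)`: the binary
logarithm of the minimum size of a rectangle cover (with value `0` for the constant `false`,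
which has the empty cover). -/
noncomputable def nondetCC {X : Type*} (f : (X → Bool) → Bool) (Y : Set X) : ℝ :=
  Real.logb 2 (sInf {s : ℕ | HasRectangleCover f Y s} : ℕ)

/-- Best-case nondeterministic communication complexity with `1/3`-balance: the minimum over all
partitions `(Y, Yᶜ)` of the finite set `X` with `min (|Y|, |Yᶜ|) ≥ |X| / 3`. (Such partitions
exist unless `|X| = 1`, where the value is `0`.) -/
noncomputable def ccBest {X : Type*} (f : (X → Bool) → Bool) : ℝ :=
  sInf {c : ℝ | ∃ Y : Set X,
    (Nat.card X : ℝ) / 3 ≤ min (Y.ncard : ℝ) ((Yᶜ).ncard : ℝ) ∧ c = nondetCC f Y}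

/-! ### Rectangle covers from cuts of the incidence graph -/

/-! A small width yields a balanced cut of the variables that little information crosses. Split
variables and clauses into two sides. A model of `C` can be certified by two players, each knowing
the variables of one side, once they share a guess of (i) which clauses of the second side the first
player satisfies, and (ii) which clauses of the first side the second player satisfies. Each guess
gives one rectangle, with auxiliary variables existentially quantified, so the cover size is the
number of guesses (`hasRectangleCover_of_states`).

For treewidth, a bag `S` at a centroid of the decomposition tree leaves components that can be
grouped into two sides, each with at least a third of `X`. Only incidences through `S` cross, so
O(|S|) bits suffice. In the primal and dual graph, clauses respectively variables are cliques, hence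
lie on one side up to `S`.

For signed cliquewidth, descending into the larger part of each union reaches a balanced
subexpression. Its vertices with equal labels have the same signed neighbors outside, so a state
needs only a constant number of bits per label. -/

/-- The clause `c` contains a literal on a variable in `U` that is true under `a`. -/
def PClause.SatisfiedOn {V : Type*} (c : PClause V) (U : Set V) (a : V → Bool) : Prop :=
  ∃ l ∈ c, l.1 ∈ U ∧ a l.1 = l.2

theorem hasRectangleCover_of_finite {X ι : Type*} [Finite ι] {f : (X → Bool) → Bool} {A : Set X}
    (r₁ : ι → (A → Bool) → Prop) (r₂ : ι → ((Aᶜ : Set X) → Bool) → Prop)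
    (h : ∀ a : X → Bool, f a = true ↔ ∃ i, r₁ i (fun x => a x) ∧ r₂ i (fun x => a x)) :
    HasRectangleCover f A (Nat.card ι) := by
  classical
  have e := Finite.equivFin ι
  refine ⟨fun i a => decide (r₁ (e.symm i) a), fun i a => decide (r₂ (e.symm i) a), fun a => ?_⟩
  rw [h a]
  constructor
  · rintro ⟨i, hi⟩
    exact ⟨e i, by simpa using hi⟩
  · rintro ⟨i, hi⟩
    exact ⟨e.symm i, by simpa using hi⟩

/-- If `φ` determines which clauses outside `W` are satisfied on `U`, and `ψ` determines which
clauses in `W` are satisfied outside `U`, then the values of `φ` and `ψ` index a rectangle cover. -/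
theorem CNFFormula.IsClausalEncoding.hasRectangleCover_of_states {X Y P Q : Type*}
    [Finite P] [Finite Q] {f : (X → Bool) → Bool} {F : CNFFormula (X ⊕ Y)}
    (hF : F.IsClausalEncoding f) (U : Set (X ⊕ Y)) (W : Set (PClause (X ⊕ Y)))
    (φ : (X ⊕ Y → Bool) → P) (ψ : (X ⊕ Y → Bool) → Q)
    (hφ : ∀ a b, φ a = φ b → ∀ c ∈ F, c ∉ W → c.SatisfiedOn U a → c.SatisfiedOn U b)
    (hψ : ∀ a b, ψ a = ψ b → ∀ c ∈ F, c ∈ W → c.SatisfiedOn Uᶜ a → c.SatisfiedOn Uᶜ b) :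
    HasRectangleCover f {x | Sum.inl x ∈ U} (Nat.card P * Nat.card Q) := by
  classical
  rw [← Nat.card_prod]
  -- Each player checks the clauses of its own side, trusting the other's state for help. "Some
  -- assignment with that state satisfies `c`" is a sound promise, because by `hφ` and `hψ` every
  -- assignment with that state then does.
  refine hasRectangleCover_of_finite
    (fun pq α => ∃ a : X ⊕ Y → Bool, (∀ x, a (Sum.inl x.1) = α x) ∧ φ a = pq.1 ∧
      ∀ c ∈ F, c ∈ W → c.SatisfiedOn U a ∨ ∃ b, ψ b = pq.2 ∧ c.SatisfiedOn Uᶜ b)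
    (fun pq β => ∃ b : X ⊕ Y → Bool, (∀ x, b (Sum.inl x.1) = β x) ∧ ψ b = pq.2 ∧
      ∀ c ∈ F, c ∉ W → c.SatisfiedOn Uᶜ b ∨ ∃ a, φ a = pq.1 ∧ c.SatisfiedOn U a)
    fun a₀ => ⟨fun h => ?_, ?_⟩
  · obtain ⟨a', ha'⟩ := hF.1 a₀ h
    set m := Sum.elim a₀ a'
    have key : ∀ c ∈ F, c.SatisfiedOn U m ∨ c.SatisfiedOn Uᶜ m := fun c hc => by
      obtain ⟨l, hl, hm⟩ := ha' c hc
      by_cases hU : l.1 ∈ U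
      · exact Or.inl ⟨l, hl, hU, hm⟩
      · exact Or.inr ⟨l, hl, hU, hm⟩
    exact ⟨(φ m, ψ m),
      ⟨m, fun x => rfl, rfl, fun c hc _ => (key c hc).imp_right fun h => ⟨m, rfl, h⟩⟩,
      ⟨m, fun x => rfl, rfl, fun c hc _ => (key c hc).symm.imp_right fun h => ⟨m, rfl, h⟩⟩⟩
  · rintro ⟨⟨p, q⟩, ⟨a, ha, hap, haF⟩, ⟨b, hb, hbq, hbF⟩⟩
    by_contra hf
    refine hF.2 a₀ (by simpa using hf) (fun y => if Sum.inr y ∈ U then a (Sum.inr y)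
      else b (Sum.inr y)) fun c hc => ?_
    set m : X ⊕ Y → Bool := Sum.elim a₀ (fun y => if Sum.inr y ∈ U then a (Sum.inr y)
      else b (Sum.inr y))
    have hmU : ∀ v ∈ U, m v = a v := by
      rintro (x | y) hv
      · exact (ha ⟨x, hv⟩).symm
      · simp [m, hv]
    have hmU' : ∀ v ∉ U, m v = b v := by
      rintro (x | y) hv
      · exact (hb ⟨x, hv⟩).symm
      · simp [m, hv]
    have hor : c.SatisfiedOn U a ∨ c.SatisfiedOn Uᶜ b := by
      by_cases hW : c ∈ W
      · rcases haF c hc hW with h | ⟨b', hb', h⟩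
        · exact Or.inl h
        · exact Or.inr (hψ _ _ (hb'.trans hbq.symm) c hc hW h)
      · rcases hbF c hc hW with h | ⟨a', ha', h⟩
        · exact Or.inr h
        · exact Or.inl (hφ _ _ (ha'.trans hap.symm) c hc hW h)
    rcases hor with ⟨l, hl, hU, h⟩ | ⟨l, hl, hU, h⟩
    · exact ⟨l, hl, (hmU _ hU).trans h⟩
    · exact ⟨l, hl, (hmU' _ hU).trans h⟩

/-- If `S` and `T` are sets of variables and clauses meeting all edges of the incidence graph
between the two sides of a cut, then assignments of `S` and truth values of `T` on both sides index
a rectangle cover. -/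
theorem CNFFormula.IsClausalEncoding.hasRectangleCover_of_vertexCover {X Y : Type*}
    {f : (X → Bool) → Bool} {F : CNFFormula (X ⊕ Y)} (hF : F.IsClausalEncoding f)
    (U : Set (X ⊕ Y)) (W : Set (PClause (X ⊕ Y)))
    (S : Finset (X ⊕ Y)) (T : Finset (PClause (X ⊕ Y)))
    (hST : ∀ c ∈ F, ∀ v, PClause.HasVar c v → ¬ (v ∈ U ↔ c ∈ W) → v ∈ S ∨ c ∈ T) :
    HasRectangleCover f {x | Sum.inl x ∈ U} (2 ^ (2 * (S.card + T.card))) := by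
  classical
  let st (U : Set (X ⊕ Y)) (a : X ⊕ Y → Bool) : (S → Bool) × (T → Bool) :=
    (fun v => a v, fun c => decide (PClause.SatisfiedOn c.1 U a))
  have key : ∀ U' : Set (X ⊕ Y), ∀ a b, st U' a = st U' b → ∀ c ∈ F,
      (∀ v ∈ U', PClause.HasVar c v → v ∈ S ∨ c ∈ T) →
      c.SatisfiedOn U' a → c.SatisfiedOn U' b := by
    rintro U' a b hab c - hc ⟨l, hl, hlU, hla⟩
    obtain ⟨h1, h2⟩ := Prod.mk.inj hab
    rcases hc l.1 hlU ⟨l.2, hl⟩ with hS | hT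
    · exact ⟨l, hl, hlU, (congrFun h1 ⟨l.1, hS⟩).symm.trans hla⟩
    · exact (decide_eq_decide.1 (congrFun h2 ⟨c, hT⟩)).1 ⟨l, hl, hlU, hla⟩
  have h := hF.hasRectangleCover_of_states U W (st U) (st Uᶜ)
    (fun a b hab c hc hcW => key U a b hab c hc fun v hv hcv =>
      hST c hc v hcv fun h => hcW (h.1 hv))
    (fun a b hab c hc hcW => key Uᶜ a b hab c hc fun v hv hcv =>
      hST c hc v hcv fun h => hv (h.2 hcW))
  have hcard : Nat.card ((S → Bool) × (T → Bool)) = 2 ^ (S.card + T.card) := by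
    simp [Nat.card_eq_fintype_card, pow_add]
  rwa [hcard, ← pow_add, ← two_mul] at h

/-! ### Bounds on communication complexity -/

theorem nondetCC_nonneg {X : Type*} (f : (X → Bool) → Bool) (A : Set X) : 0 ≤ nondetCC f A := by
  unfold nondetCC
  rcases Nat.eq_zero_or_pos (sInf {s : ℕ | HasRectangleCover f A s}) with h0 | h0
  · simp [h0]
  · exact Real.logb_nonneg (by norm_num) (by exact_mod_cast h0)

theorem nondetCC_le_of_hasRectangleCover {X : Type*} {f : (X → Bool) → Bool} {A : Set X} {m : ℕ}
    (h : HasRectangleCover f A (2 ^ m)) : nondetCC f A ≤ m := by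
  unfold nondetCC
  have hle : sInf {s : ℕ | HasRectangleCover f A s} ≤ 2 ^ m := Nat.sInf_le h
  rcases Nat.eq_zero_or_pos (sInf {s : ℕ | HasRectangleCover f A s}) with h0 | h0
  · simp [h0]
  · rw [Real.logb_le_iff_le_rpow (by norm_num) (by exact_mod_cast h0), Real.rpow_natCast]
    exact_mod_cast hle

theorem ccBest_le_nondetCC {X : Type*} [Finite X] (f : (X → Bool) → Bool) {A : Set X}
    (h₁ : Nat.card X ≤ 3 * A.ncard) (h₂ : Nat.card X ≤ 3 * Aᶜ.ncard) :
    ccBest f ≤ nondetCC f A := by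
  refine csInf_le ⟨0, ?_⟩ ⟨A, le_min ?_ ?_, rfl⟩
  · rintro c ⟨B, -, rfl⟩
    exact nondetCC_nonneg f B
  · rw [div_le_iff₀ (by norm_num), mul_comm]
    exact_mod_cast h₁
  · rw [div_le_iff₀ (by norm_num), mul_comm]
    exact_mod_cast h₂

/-- For empty `X` one rectangle covers the constant `f`. For a single variable no balanced partition
exists, and `sInf ∅ = 0`. -/
theorem ccBest_nonpos_of_card_le_one {X : Type*} [Finite X] (f : (X → Bool) → Bool)
    (h : Nat.card X ≤ 1) : ccBest f ≤ 0 := by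
  rcases Nat.le_one_iff_eq_zero_or_eq_one.1 h with h0 | h1
  · have : IsEmpty X := by
      rcases Nat.card_eq_zero.1 h0 with h | h
      · exact h
      · exact absurd ‹Finite X› (by simpa using h)
    have hc : HasRectangleCover f ∅ (2 ^ 0) := by
      refine ⟨fun _ _ => f isEmptyElim, fun _ _ => true, fun a => ?_⟩
      rw [Subsingleton.elim a isEmptyElim]
      exact ⟨fun h => ⟨0, h, rfl⟩, fun ⟨_, h, _⟩ => h⟩
    refine (ccBest_le_nondetCC f (A := ∅) (by simp) (by simp)).trans ?_
    simpa using nondetCC_le_of_hasRectangleCover hc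
  · unfold ccBest
    refine (congrArg sInf (Set.eq_empty_iff_forall_notMem.2 ?_)).trans_le Real.sInf_empty.le
    rintro c ⟨A, hA, -⟩
    have hsum := Set.ncard_add_ncard_compl A
    rw [h1] at hA hsum
    rw [le_min_iff] at hA
    have h2 : A.ncard = 0 ∨ Aᶜ.ncard = 0 := by omega
    rcases h2 with h2 | h2 <;> rw [h2] at hA <;> norm_num at hA

/-! ### Balanced grouping -/

/-- A fiber holding at least a third of `X` is balanced alone, as it holds at most half. Otherwise a
smallest set of fibers reaching a third stays below two thirds, since dropping one fiber falls below
a third. -/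
theorem exists_balanced_preimage {X I : Type*} [Finite X] (κ : X → I)
    (hκ : ∀ i, 2 * (κ ⁻¹' {i}).ncard ≤ Nat.card X) :
    ∃ J : Set I, Nat.card X ≤ 3 * (κ ⁻¹' J).ncard ∧ Nat.card X ≤ 3 * (κ ⁻¹' J)ᶜ.ncard := by
  classical
  have hcompl (A : Set X) : A.ncard + Aᶜ.ncard = Nat.card X := Set.ncard_add_ncard_compl A
  by_cases hbig : ∃ i, Nat.card X ≤ 3 * (κ ⁻¹' {i}).ncard
  · obtain ⟨i, hi⟩ := hbig
    have := hκ i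
    have := hcompl (κ ⁻¹' {i})
    exact ⟨{i}, hi, by omega⟩
  push Not at hbig
  have hex : ∃ n, ∃ J : Finset I, J.card = n ∧ Nat.card X ≤ 3 * (κ ⁻¹' (J : Set I)).ncard := by
    refine ⟨_, (Set.toFinite (Set.range κ)).toFinset, rfl, ?_⟩
    simp only [Set.Finite.coe_toFinset, Set.preimage_range, Set.ncard_univ]
    omega
  obtain ⟨J, hJn, hJ⟩ := Nat.find_spec hex
  refine ⟨J, hJ, ?_⟩
  have h1 := hcompl (κ ⁻¹' (J : Set I))
  rcases J.eq_empty_or_nonempty with rfl | ⟨i, hi⟩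
  · simp only [Finset.coe_empty, Set.preimage_empty, Set.ncard_empty] at h1 ⊢
    omega
  have hmin := Nat.find_min hex (m := (J.erase i).card)
    (by rw [← hJn]; exact Finset.card_erase_lt_of_mem hi)
  have h2 : ¬ Nat.card X ≤ 3 * (κ ⁻¹' ((J.erase i : Finset I) : Set I)).ncard :=
    fun h => hmin ⟨_, rfl, h⟩
  have h3 : (κ ⁻¹' (J : Set I)).ncard ≤
      (κ ⁻¹' ((J.erase i : Finset I) : Set I)).ncard + (κ ⁻¹' {i}).ncard := by
    refine le_trans (Set.ncard_le_ncard ?_) (Set.ncard_union_le _ _)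
    intro x hx
    by_cases hxi : κ x = i
    · exact Or.inr hxi
    · exact Or.inl (by simpa [hxi] using hx)
  have := hbig i
  omega

/-! ### Balanced separators from tree decompositions -/

namespace SimpleGraph

variable {N : Type*} {T : SimpleGraph N}

theorem not_reachable_deleteIncidenceSet {t u : N} (h : u ≠ t) :
    ¬ (T.deleteIncidenceSet t).Reachable t u := by
  rintro ⟨p⟩
  cases p with
  | nil => exact h rfl
  | cons hadj _ => exact (deleteIncidenceSet_adj.1 hadj).2.1 rfl

theorem Walk.exists_adj_reachable_deleteIncidenceSet {t u : N} (p : T.Walk u t) (hu : u ≠ t) :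
    ∃ c, T.Adj t c ∧ (T.deleteIncidenceSet t).Reachable u c := by
  induction p with
  | nil => exact absurd rfl hu
  | @cons u v t hadj p ih =>
    by_cases hv : v = t
    · subst hv
      exact ⟨u, hadj.symm, Reachable.refl _⟩
    · obtain ⟨c, hc, hr⟩ := ih hv
      exact ⟨c, hc, (deleteIncidenceSet_adj.2 ⟨hadj, hu, hv⟩).reachable.trans hr⟩

/-- Cut the walk at its first visit to `t` or `c`. -/
theorem Walk.reachable_deleteIncidenceSet_or {t c u : N} (p : T.Walk u c) (htc : t ≠ c) :
    (T.deleteIncidenceSet t).Reachable u c ∨ (T.deleteIncidenceSet c).Reachable u t := by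
  induction p with
  | nil => exact Or.inl (Reachable.refl _)
  | @cons u v c hadj p ih =>
    by_cases hut : u = t
    · subst hut; exact Or.inr (Reachable.refl _)
    by_cases huc : u = c
    · subst huc; exact Or.inl (Reachable.refl _)
    by_cases hvt : v = t
    · subst hvt; exact Or.inr (deleteIncidenceSet_adj.2 ⟨hadj, huc, htc⟩).reachable
    by_cases hvc : v = c
    · subst hvc; exact Or.inl (deleteIncidenceSet_adj.2 ⟨hadj, hut, hvt⟩).reachable
    exact (ih htc).imp (deleteIncidenceSet_adj.2 ⟨hadj, hut, hvt⟩).reachable.trans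
      (deleteIncidenceSet_adj.2 ⟨hadj, huc, hvc⟩).reachable.trans

/-- Otherwise `t` and `c` would be connected through `u` without the edge `tc`, which is a bridge.
-/
theorem IsAcyclic.not_reachable_deleteIncidenceSet_and (hT : T.IsAcyclic) {t c : N}
    (htc : T.Adj t c) (u : N) :
    ¬ ((T.deleteIncidenceSet t).Reachable c u ∧ (T.deleteIncidenceSet c).Reachable t u) := by
  rintro ⟨h1, h2⟩
  have hb := isAcyclic_iff_forall_adj_isBridge.1 hT htc
  rw [isBridge_iff] at hb
  refine hb ((h2.mono ?_).trans (h1.mono ?_).symm)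
  all_goals
    intro a b hab
    rw [deleteIncidenceSet_adj] at hab
    rw [deleteEdges_adj]
    refine ⟨hab.1, ?_⟩
    simp only [Set.mem_singleton_iff, Sym2.eq_iff]
    rintro (⟨rfl, rfl⟩ | ⟨rfl, rfl⟩)
    all_goals simp at hab

/-- In a finite tree, a family of weights on branches such that branches pointing at each other
along an edge carry total weight at most `n` has a node all of whose branches have weight at most
`n / 2`. -/
theorem IsTree.exists_centroid [Finite N] (hT : T.IsTree) (w : N → N → ℕ) (n : ℕ)
    (hw : ∀ t c q q', T.Adj t c → (∀ u, ¬ ((T.deleteIncidenceSet t).Reachable q u ∧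
      (T.deleteIncidenceSet c).Reachable q' u)) → w t q + w c q' ≤ n) :
    ∃ t, ∀ q, q ≠ t → 2 * w t q ≤ n := by
  by_contra! hcon
  choose q hq hwq using hcon
  have : Nonempty N := hT.1.nonempty
  -- Choose `t` whose heavy branch has the fewest nodes, and let `c` be the neighbor of `t` in it.
  -- If the heavy branch at `c` points back to `t`, the two weights exceed `n`; if not, it is a
  -- strictly smaller heavy branch, as it misses `c`.
  obtain ⟨t, ht⟩ := Finite.exists_min
    fun t => {u | (T.deleteIncidenceSet t).Reachable (q t) u}.ncard
  obtain ⟨p⟩ := hT.1.preconnected (q t) t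
  obtain ⟨c, htc, hqc⟩ := p.exists_adj_reachable_deleteIncidenceSet (hq t)
  by_cases hct : (T.deleteIncidenceSet c).Reachable (q c) t
  · have := hw t c (q t) (q c) htc fun u ⟨h1, h2⟩ =>
      hT.2.not_reachable_deleteIncidenceSet_and htc u ⟨hqc.symm.trans h1, hct.symm.trans h2⟩
    have := hwq t
    have := hwq c
    omega
  · refine absurd (ht c) (not_le.2 (Set.ncard_lt_ncard ?_))
    refine ⟨fun u hu => ?_, fun hsub => ?_⟩
    · obtain ⟨p⟩ := hT.1.preconnected u c
      rcases p.reachable_deleteIncidenceSet_or htc.ne with h | h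
      · exact hqc.trans h.symm
      · exact absurd (Reachable.trans hu h) hct
    · exact not_reachable_deleteIncidenceSet (hq c) (hsub hqc : _).symm

end SimpleGraph

namespace TreeDecomposition

variable {V : Type*} {G : SimpleGraph V}

/-- The nodes whose bags contain `v` form a subtree avoiding `t`. -/
theorem reachable_deleteIncidenceSet (D : TreeDecomposition G) {t u u' : Fin D.size} {v : V}
    (hv : v ∉ D.bag t) (hu : v ∈ D.bag u) (hu' : v ∈ D.bag u') :
    (D.tree.deleteIncidenceSet t).Reachable u u' := by
  let φ : D.tree.induce {t | v ∈ D.bag t} →g D.tree.deleteIncidenceSet t :=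
    { toFun := Subtype.val
      map_rel' := fun {a b} hab => SimpleGraph.deleteIncidenceSet_adj.2
        ⟨hab, fun h => hv (h ▸ a.2), fun h => hv (h ▸ b.2)⟩ }
  exact ((D.connected v).preconnected ⟨u, hu⟩ ⟨u', hu'⟩).map φ

theorem card_bag_le (D : TreeDecomposition G) (t : Fin D.size) :
    (D.bag t).card ≤ D.width + 1 := by
  have : (D.bag t).card ≤ Finset.univ.sup fun t => (D.bag t).card :=
    Finset.le_sup (f := fun t => (D.bag t).card) (Finset.mem_univ t)
  unfold width
  omega

/-- Let `N` assign to each `x : X` a clique of `G`. Then a bag `S` of the tree decomposition admits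
a cut of `G - S` without crossing edges, and a compatible balanced cut of `X`. -/
theorem exists_balanced_cut (D : TreeDecomposition G) {X : Type*} [Finite X] (N : X → Set V)
    (hN : ∀ x, ∀ u ∈ N x, ∀ v ∈ N x, u = v ∨ G.Adj u v) (hX : 2 ≤ Nat.card X) :
    ∃ (S : Finset V) (U : Set V) (A : Set X), S.card ≤ D.width + 1 ∧
      (∀ u v, G.Adj u v → u ∉ S → v ∉ S → u ∈ U → v ∈ U) ∧
      (∀ x, ∀ v ∈ N x, v ∉ S → (x ∈ A ↔ v ∈ U)) ∧
      Nat.card X ≤ 3 * A.ncard ∧ Nat.card X ≤ 3 * Aᶜ.ncard := by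
  classical
  have hN' : ∀ x, ∀ u ∈ N x, ∀ v ∈ N x, ∃ s, u ∈ D.bag s ∧ v ∈ D.bag s := by
    intro x u hu v hv
    rcases hN x u hu v hv with rfl | h
    · exact (D.vertex_mem u).imp fun s hs => ⟨hs, hs⟩
    · exact D.edge_mem u v h
  choose node hnode using D.vertex_mem
  -- The `x` with a vertex of `N x` living only in the branch of `q` at `t`. Opposite branches get
  -- disjoint sets, since two vertices of a clique share a bag.
  let W (t q : Fin D.size) : Set X :=
    {x | ∃ v ∈ N x, ∀ u, v ∈ D.bag u → (D.tree.deleteIncidenceSet t).Reachable q u}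
  obtain ⟨t, ht⟩ := D.isTree.exists_centroid (fun t q => (W t q).ncard) (Nat.card X) (by
    intro t c q q' _ hdis
    rw [← Set.ncard_union_eq, ← Set.ncard_univ]
    · exact Set.ncard_le_ncard (Set.subset_univ _)
    · rw [Set.disjoint_left]
      rintro x ⟨v, hv, h⟩ ⟨v', hv', h'⟩
      obtain ⟨s, hs, hs'⟩ := hN' x v hv v' hv'
      exact hdis s ⟨h s hs, h' s hs'⟩)
  let comp (v : V) : (D.tree.deleteIncidenceSet t).ConnectedComponent :=
    (D.tree.deleteIncidenceSet t).connectedComponentMk (node v)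
  have hcomp : ∀ u v, u ∉ D.bag t → v ∉ D.bag t → (∃ s, u ∈ D.bag s ∧ v ∈ D.bag s) →
      comp u = comp v := by
    rintro u v hu hv ⟨s, hsu, hsv⟩
    exact SimpleGraph.ConnectedComponent.sound
      ((D.reachable_deleteIncidenceSet hu (hnode u) hsu).trans
        (D.reachable_deleteIncidenceSet hv hsv (hnode v)))
  -- All of `N x` outside the bag lies in one component. An `x` with `N x` inside the bag is free
  -- and forms its own group.
  let κ (x : X) : X ⊕ (D.tree.deleteIncidenceSet t).ConnectedComponent :=
    if h : ∃ v ∈ N x, v ∉ D.bag t then Sum.inr (comp h.choose) else Sum.inl x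
  have hκ : ∀ x, ∀ v ∈ N x, v ∉ D.bag t → κ x = Sum.inr (comp v) := by
    intro x v hv hvt
    have h : ∃ v ∈ N x, v ∉ D.bag t := ⟨v, hv, hvt⟩
    simp only [κ, dif_pos h]
    rw [hcomp _ v h.choose_spec.2 hvt (hN' x _ h.choose_spec.1 v hv)]
  obtain ⟨J, hJ, hJ'⟩ := exists_balanced_preimage κ (by
    rintro (x | q)
    · have : (κ ⁻¹' {Sum.inl x}).ncard ≤ 1 := by
        rw [← Set.ncard_singleton x]
        refine Set.ncard_le_ncard fun y hy => ?_
        simp only [κ, Set.mem_preimage, Set.mem_singleton_iff] at hy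
        split_ifs at hy
        exact Sum.inl.inj hy
      omega
    · rcases (κ ⁻¹' {Sum.inr q}).eq_empty_or_nonempty with h | ⟨x, hx⟩
      · simp [h]
      have hmem : ∀ y ∈ κ ⁻¹' {Sum.inr q}, ∃ v ∈ N y, v ∉ D.bag t ∧ comp v = q := by
        intro y hy
        by_cases h : ∃ v ∈ N y, v ∉ D.bag t
        · obtain ⟨v, hv, hvt⟩ := h
          exact ⟨v, hv, hvt, Sum.inr.inj ((hκ y v hv hvt).symm.trans hy)⟩
        · simp [κ, dif_neg h] at hy
      obtain ⟨v, hv, hvt, rfl⟩ := hmem x hx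
      refine le_trans (Nat.mul_le_mul_left 2 (Set.ncard_le_ncard fun y hy => ?_))
        (ht (node v) fun h => hvt (h ▸ hnode v))
      obtain ⟨v', hv', hvt', hc⟩ := hmem y hy
      exact ⟨v', hv', fun u hu => (SimpleGraph.ConnectedComponent.exact hc).symm.trans
        (D.reachable_deleteIncidenceSet hvt' (hnode v') hu)⟩)
  refine ⟨D.bag t, {v | Sum.inr (comp v) ∈ J}, κ ⁻¹' J, D.card_bag_le t, ?_, ?_, hJ, hJ'⟩
  · intro u v huv hu hv h
    rwa [Set.mem_ofPred_eq, ← hcomp u v hu hv (D.edge_mem u v huv)]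
  · intro x v hv hvt
    rw [Set.mem_preimage, hκ x v hv hvt, Set.mem_ofPred_eq]

/-- The decomposition with a single bag. -/
def trivial [Fintype V] (G : SimpleGraph V) : TreeDecomposition G where
  size := 1
  tree := ⊥
  isTree := SimpleGraph.IsTree.of_subsingleton
  bag _ := Finset.univ
  vertex_mem _ := ⟨0, Finset.mem_univ _⟩
  edge_mem _ _ _ := ⟨0, Finset.mem_univ _, Finset.mem_univ _⟩
  connected v :=
    { preconnected := fun a b => by rw [Subsingleton.elim a b]
      nonempty := ⟨⟨0, Finset.mem_univ _⟩⟩ }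

end TreeDecomposition

theorem SimpleGraph.exists_width_eq_treewidth {V : Type*} [Finite V] (G : SimpleGraph V) :
    ∃ D : TreeDecomposition G, D.width = G.treewidth := by
  have := Fintype.ofFinite V
  exact Nat.sInf_mem (Set.range_nonempty_iff_nonempty.2 ⟨TreeDecomposition.trivial G⟩)

/-- A balanced cut of a set of vertices whose crossing edges are covered by few vertices. -/
theorem SimpleGraph.exists_balanced_cut {V X : Type*} [Finite V] [Finite X] (G : SimpleGraph V)
    (ι : X → V) (hι : Function.Injective ι) (hX : 2 ≤ Nat.card X) :
    ∃ (S : Finset V) (U : Set V), S.card ≤ 2 * G.treewidth ∧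
      (∀ u v, G.Adj u v → u ∈ U → v ∉ U → u ∈ S ∨ v ∈ S) ∧
      Nat.card X ≤ 3 * (ι ⁻¹' U).ncard ∧ Nat.card X ≤ 3 * (ι ⁻¹' U)ᶜ.ncard := by
  classical
  obtain ⟨D, hD⟩ := G.exists_width_eq_treewidth
  -- A bag has up to `width + 1` vertices, which is at most `2 * width` only for positive width.
  -- Width zero means no edges, so no cover is needed.
  rcases Nat.eq_zero_or_pos G.treewidth with h0 | h0
  · have hG : ∀ u v, ¬ G.Adj u v := fun u v huv => by
      obtain ⟨t, hu, hv⟩ := D.edge_mem u v huv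
      have h1 := D.card_bag_le t
      have h2 : 1 < (D.bag t).card := Finset.one_lt_card.2 ⟨u, hu, v, hv, huv.ne⟩
      omega
    obtain ⟨J, hJ, hJ'⟩ := exists_balanced_preimage (id : X → X)
      (fun i => by simpa using hX)
    refine ⟨∅, ι '' J, by simp, fun u v h => absurd h (hG u v), ?_, ?_⟩ <;>
      rw [Set.preimage_image_eq _ hι] <;> assumption
  · obtain ⟨S, U, A, hS, hU, hA, hA1, hA2⟩ := D.exists_balanced_cut (fun x => {ι x})
      (by rintro x u rfl v rfl; exact Or.inl rfl) hX
    -- Vertices of `S` may change sides freely, so those from `X` are placed according to `A`.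
    have hpre : ι ⁻¹' ((U \ S) ∪ ι '' A) = A := by
      ext x
      simp only [Set.mem_preimage, Set.mem_union, Set.mem_sdiff, Finset.mem_coe,
        hι.mem_set_image]
      exact ⟨fun h => h.elim (fun h => (hA x _ rfl h.2).2 h.1) id, Or.inr⟩
    have hmem : ∀ v ∉ S, v ∈ (U \ S) ∪ ι '' A ↔ v ∈ U := by
      intro v hv
      refine ⟨?_, fun h => Or.inl ⟨h, hv⟩⟩
      rintro (h | ⟨x, hx, rfl⟩)
      · exact h.1
      · exact (hA x _ rfl hv).1 hx
    refine ⟨S, (U \ S) ∪ ι '' A, by omega, fun u v huv hu hv => ?_, by rwa [hpre], by rwa [hpre]⟩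
    by_contra! h
    exact hv ((hmem v h.2).2 (hU u v huv h.1 h.2 ((hmem u h.1).1 hu)))

/-! ### Treewidth bounds -/

namespace CNFFormula.IsClausalEncoding

variable {X Y : Type*} [Finite X] {f : (X → Bool) → Bool} {F : CNFFormula (X ⊕ Y)}

theorem ccBest_le_of_vertexCover (hF : F.IsClausalEncoding f) (U : Set (X ⊕ Y))
    (W : Set (PClause (X ⊕ Y))) (S : Finset (X ⊕ Y)) (T : Finset (PClause (X ⊕ Y)))
    (hST : ∀ c ∈ F, ∀ v, PClause.HasVar c v → ¬ (v ∈ U ↔ c ∈ W) → v ∈ S ∨ c ∈ T)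
    (h₁ : Nat.card X ≤ 3 * {x | Sum.inl x ∈ U}.ncard)
    (h₂ : Nat.card X ≤ 3 * {x | Sum.inl x ∈ U}ᶜ.ncard) {n : ℕ} (hn : S.card + T.card ≤ 2 * n) :
    ccBest f ≤ 4 * n := by
  refine ((ccBest_le_nondetCC f h₁ h₂).trans (nondetCC_le_of_hasRectangleCover
    (hF.hasRectangleCover_of_vertexCover U W S T hST))).trans ?_
  have : 2 * (S.card + T.card) ≤ 4 * n := by omega
  exact_mod_cast this

theorem ccBest_le_twi [Finite Y] (hF : F.IsClausalEncoding f) (hX : 2 ≤ Nat.card X) :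
    ccBest f ≤ 4 * F.twi := by
  classical
  obtain ⟨S, U, hS, hU, h₁, h₂⟩ := F.incidenceGraph.exists_balanced_cut
    (fun x : X => Sum.inl (Sum.inl x)) (Sum.inl_injective.comp Sum.inl_injective) hX
  refine hF.ccBest_le_of_vertexCover (Sum.inl ⁻¹' U) {c | ∃ h : c ∈ F, Sum.inr ⟨c, h⟩ ∈ U}
    S.toLeft (S.toRight.map (Function.Embedding.subtype _)) ?_ h₁ h₂
    (by rw [Finset.card_map, Finset.card_toLeft_add_card_toRight]; exact hS)
  intro c hc v hcv hne
  have hadj : F.incidenceGraph.Adj (Sum.inl v) (Sum.inr ⟨c, hc⟩) := hcv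
  have hcov : Sum.inl v ∈ S ∨ Sum.inr ⟨c, hc⟩ ∈ S := by
    by_cases hv : Sum.inl v ∈ U
    · exact hU _ _ hadj hv fun h => hne ⟨fun _ => ⟨hc, h⟩, fun _ => hv⟩
    · refine (hU _ _ hadj.symm ?_ hv).symm
      by_contra h
      exact hne ⟨fun h => absurd h hv, fun ⟨_, h'⟩ => absurd h' h⟩
  simpa [hc] using hcov

theorem ccBest_le_twp [Finite Y] (hF : F.IsClausalEncoding f) (hX : 2 ≤ Nat.card X) :
    ccBest f ≤ 4 * F.twp := by
  obtain ⟨S, U, hS, hU, h₁, h₂⟩ := F.primalGraph.exists_balanced_cut Sum.inl Sum.inl_injective hX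
  refine hF.ccBest_le_of_vertexCover U {c | ∃ v, PClause.HasVar c v ∧ v ∈ U ∧ v ∉ S} S ∅ ?_ h₁ h₂
    hS
  intro c hc v hcv hne
  by_contra! hv
  by_cases hvU : v ∈ U
  · exact hne ⟨fun _ => ⟨v, hcv, hvU, hv.1⟩, fun _ => hvU⟩
  · refine hne ⟨fun h => absurd h hvU, ?_⟩
    rintro ⟨u, hcu, huU, huS⟩
    have hadj : F.primalGraph.Adj u v := ⟨fun h => hvU (h ▸ huU), c, hc, hcu, hcv⟩
    exact absurd (hU _ _ hadj huU hvU) (by simp [huS, hv.1])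

theorem ccBest_le_twd (hF : F.IsClausalEncoding f) (hX : 2 ≤ Nat.card X) :
    ccBest f ≤ 4 * (max 1 F.twd : ℕ) := by
  obtain ⟨D, hD⟩ := F.dualGraph.exists_width_eq_treewidth
  obtain ⟨S, U, A, hS, hU, hA, h₁, h₂⟩ := D.exists_balanced_cut
    (fun x : X => {c | PClause.HasVar c.1 (Sum.inl x)})
    (fun x c hc d hd => or_iff_not_imp_left.2 fun h => ⟨h, _, hc, hd⟩) hX
  refine hF.ccBest_le_of_vertexCover
    (Sum.inl '' A ∪ Sum.inr '' {y | ∃ c ∈ U, c ∉ S ∧ PClause.HasVar c.1 (Sum.inr y)})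
    {c | ∃ h : c ∈ F, ⟨c, h⟩ ∈ U} ∅ (S.map (Function.Embedding.subtype _)) ?_
    (by simpa using h₁) (by simpa using h₂) (n := max 1 F.twd)
    (by rw [Finset.card_map, Finset.card_empty, twd, ← hD]; omega)
  intro c hc v hcv hne
  by_contra! hv
  have hcS : (⟨c, hc⟩ : {c // c ∈ F}) ∉ S := fun h => hv.2 (by simpa [hc] using h)
  have hW : c ∈ {c | ∃ h : c ∈ F, ⟨c, h⟩ ∈ U} ↔ (⟨c, hc⟩ : {c // c ∈ F}) ∈ U :=
    ⟨fun ⟨_, h⟩ => h, fun h => ⟨hc, h⟩⟩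
  rw [hW] at hne
  rcases v with x | y
  · exact hne (by simpa using hA x ⟨c, hc⟩ hcv hcS)
  · refine hne ⟨?_, fun h => Or.inr ⟨y, ⟨_, h, hcS, hcv⟩, rfl⟩⟩
    rintro (⟨x, -, h⟩ | ⟨y', ⟨d, hd, hdS, hdy⟩, h⟩)
    · cases h
    · cases h
      by_cases hdc : d = ⟨c, hc⟩
      · exact hdc ▸ hd
      · exact hU d ⟨c, hc⟩ ⟨hdc, _, hdy, hcv⟩ hdS hcS hd

end CNFFormula.IsClausalEncoding

/-! ### Cuts from signed cliquewidth expressions -/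

namespace SignedExpr

variable {V : Type*} {k : ℕ}

theorem HasLabel.mem_verts {e : SignedExpr V k} {v : V} {i : Fin k} (h : e.HasLabel v i) :
    v ∈ e.verts := by
  induction e generalizing i with
  | create w j => exact h.1
  | union e₁ e₂ ih₁ ih₂ => exact h.imp ih₁ ih₂
  | join s i j hij e ih => exact ih h
  | rename a b hab e ih => exact h.elim (fun h => ih h.1) (fun h => ih h.1)

theorem HasLabel.unique {e : SignedExpr V k} (he : e.Valid) {v : V} {i j : Fin k}
    (hi : e.HasLabel v i) (hj : e.HasLabel v j) : i = j := by
  induction e generalizing i j with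
  | create w l => exact hi.2.trans hj.2.symm
  | union e₁ e₂ ih₁ ih₂ =>
    have hdis := Set.disjoint_left.1 he.2.2
    rcases hi with hi | hi <;> rcases hj with hj | hj
    · exact ih₁ he.1 hi hj
    · exact absurd hj.mem_verts (hdis hi.mem_verts)
    · exact absurd hi.mem_verts (hdis hj.mem_verts)
    · exact ih₂ he.2.1 hi hj
  | join s a b hab e ih => exact ih he hi hj
  | rename a b hab e ih =>
    rcases hi with ⟨hi, hia⟩ | ⟨hi, rfl⟩ <;> rcases hj with ⟨hj, hja⟩ | ⟨hj, rfl⟩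
    · exact ih he hi hj
    · exact absurd (ih he hi hj) hia
    · exact absurd (ih he hj hi) hja
    · rfl

theorem exists_hasLabel {e : SignedExpr V k} {v : V} (h : v ∈ e.verts) : ∃ i, e.HasLabel v i := by
  induction e with
  | create w j => exact ⟨j, h, rfl⟩
  | union e₁ e₂ ih₁ ih₂ =>
    rcases h with h | h
    · exact (ih₁ h).imp fun _ => Or.inl
    · exact (ih₂ h).imp fun _ => Or.inr
  | join s i j hij e ih => exact ih h
  | rename a b hab e ih =>
    obtain ⟨i, hi⟩ := ih h
    by_cases hia : i = a
    · exact ⟨b, Or.inr ⟨hia ▸ hi, rfl⟩⟩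
    · exact ⟨i, Or.inl ⟨hi, hia⟩⟩

theorem Edge.mem_verts {e : SignedExpr V k} {s : Bool} {u v : V} (h : e.Edge s u v) :
    u ∈ e.verts ∧ v ∈ e.verts := by
  induction e with
  | create w j => exact h.elim
  | union e₁ e₂ ih₁ ih₂ =>
    rcases h with h | h
    · exact ⟨Or.inl (ih₁ h).1, Or.inl (ih₁ h).2⟩
    · exact ⟨Or.inr (ih₂ h).1, Or.inr (ih₂ h).2⟩
  | join s i j hij e ih =>
    rcases h with h | ⟨-, h | h⟩
    · exact ih h
    · exact ⟨h.1.mem_verts, h.2.mem_verts⟩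
    · exact ⟨h.1.mem_verts, h.2.mem_verts⟩
  | rename a b hab e ih => exact ih h

/-- The properties shared by all subexpressions of an expression that constructs `G`. -/
structure IsPartOf (e : SignedExpr V k) (G : SignedGraph V) : Prop where
  valid : e.Valid
  adj_of_edge : ∀ s u w, e.Edge s u w → (G s).Adj u w
  adj_of_notMem : ∀ i u v, e.HasLabel u i → e.HasLabel v i → ∀ w ∉ e.verts, ∀ s,
    (G s).Adj u w → (G s).Adj v w
  -- Edges of `G` still missing between two label classes can only be added for all pairs at once.
  edge_or_adj : ∀ i u v, e.HasLabel u i → e.HasLabel v i → ∀ j w z, e.HasLabel w j →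
    e.HasLabel z j → ∀ s, (G s).Adj u w → e.Edge s u w ∨ (G s).Adj v z

theorem Constructs.isPartOf {e : SignedExpr V k} {G : SignedGraph V} (h : e.Constructs G) :
    e.IsPartOf G where
  valid := h.1
  adj_of_edge s u w := (h.2.2 s u w).1
  adj_of_notMem _ _ _ _ _ w hw := absurd (h.2.1 ▸ Set.mem_univ w) hw
  edge_or_adj _ u _ _ _ _ w _ _ _ s huw := Or.inl ((h.2.2 s u w).2 huw)

theorem IsPartOf.of_join {G : SignedGraph V} {s : Bool} {i j : Fin k} {hij : i ≠ j}
    {e : SignedExpr V k} (h : (join s i j hij e).IsPartOf G) : e.IsPartOf G where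
  valid := h.valid
  adj_of_edge s u w hw := h.adj_of_edge s u w (Or.inl hw)
  adj_of_notMem := h.adj_of_notMem
  edge_or_adj a u v hu hv b w z hw hz t huw := by
    rcases h.edge_or_adj a u v hu hv b w z hw hz t huw with (h' | h') | h'
    · exact Or.inl h'
    -- If this join supplied `uw`, it also joined `vz`, which carries the same labels.
    · obtain ⟨rfl, ⟨h₁, h₂⟩ | ⟨h₁, h₂⟩⟩ := h'
      · obtain rfl := HasLabel.unique (e := e) h.valid hu h₁
        obtain rfl := HasLabel.unique (e := e) h.valid hw h₂
        exact Or.inr (h.adj_of_edge _ _ _ (Or.inr ⟨rfl, Or.inl ⟨hv, hz⟩⟩))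
      · obtain rfl := HasLabel.unique (e := e) h.valid hu h₁
        obtain rfl := HasLabel.unique (e := e) h.valid hw h₂
        exact Or.inr (h.adj_of_edge _ _ _ (Or.inr ⟨rfl, Or.inr ⟨hv, hz⟩⟩))
    · exact Or.inr h'

theorem IsPartOf.of_rename {G : SignedGraph V} {i j : Fin k} {hij : i ≠ j}
    {e : SignedExpr V k} (h : (rename i j hij e).IsPartOf G) : e.IsPartOf G := by
  have hl : ∀ a, ∃ b, ∀ v, e.HasLabel v a → (rename i j hij e).HasLabel v b := by
    intro a
    by_cases ha : a = i
    · exact ⟨j, fun v hv => Or.inr ⟨ha ▸ hv, rfl⟩⟩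
    · exact ⟨a, fun v hv => Or.inl ⟨hv, ha⟩⟩
  refine ⟨h.valid, h.adj_of_edge, fun a u v hu hv => ?_, fun a u v hu hv b w z hw hz => ?_⟩
  · obtain ⟨a', ha'⟩ := hl a
    exact h.adj_of_notMem a' u v (ha' u hu) (ha' v hv)
  · obtain ⟨a', ha'⟩ := hl a
    obtain ⟨b', hb'⟩ := hl b
    exact h.edge_or_adj a' u v (ha' u hu) (ha' v hv) b' w z (hb' w hw) (hb' z hz)

theorem IsPartOf.of_union_left {G : SignedGraph V} {e₁ e₂ : SignedExpr V k}
    (h : (union e₁ e₂).IsPartOf G) : e₁.IsPartOf G := by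
  have hdis := Set.disjoint_left.1 h.valid.2.2
  refine ⟨h.valid.1, fun s u w hw => h.adj_of_edge s u w (Or.inl hw), ?_, ?_⟩
  · intro a u v hu hv w hw s huw
    by_cases hw₂ : w ∈ e₂.verts
    · obtain ⟨j, hj⟩ := exists_hasLabel hw₂
      rcases h.edge_or_adj a u v (Or.inl hu) (Or.inl hv) j w w (Or.inr hj) (Or.inr hj) s huw with
        (h' | h') | h'
      · exact absurd h'.mem_verts.2 hw
      · exact absurd h'.mem_verts.1 (hdis hu.mem_verts)
      · exact h'
    · exact h.adj_of_notMem a u v (Or.inl hu) (Or.inl hv) w (fun h => h.elim hw hw₂) s huw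
  · intro a u v hu hv b w z hw hz s huw
    rcases h.edge_or_adj a u v (Or.inl hu) (Or.inl hv) b w z (Or.inl hw) (Or.inl hz) s huw with
      (h' | h') | h'
    · exact Or.inl h'
    · exact absurd h'.mem_verts.1 (hdis hu.mem_verts)
    · exact Or.inr h'

theorem IsPartOf.union_comm {G : SignedGraph V} {e₁ e₂ : SignedExpr V k}
    (h : (union e₁ e₂).IsPartOf G) : (union e₂ e₁).IsPartOf G where
  valid := ⟨h.valid.2.1, h.valid.1, h.valid.2.2.symm⟩
  adj_of_edge s u w hw := h.adj_of_edge s u w hw.symm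
  adj_of_notMem a u v hu hv w hw :=
    h.adj_of_notMem a u v hu.symm hv.symm w fun hw' => hw hw'.symm
  edge_or_adj a u v hu hv b w z hw hz s huw :=
    (h.edge_or_adj a u v hu.symm hv.symm b w z hw.symm hz.symm s huw).imp_left Or.symm

theorem IsPartOf.exists_label {e : SignedExpr V k} {G : SignedGraph V} (h : e.IsPartOf G) :
    ∃ lab : e.verts → Fin k, ∀ u v, lab u = lab v → ∀ w ∉ e.verts, ∀ s,
      (G s).Adj u w → (G s).Adj v w := by
  choose lab hlab using fun v : e.verts => exists_hasLabel v.2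
  exact ⟨lab, fun u v huv => h.adj_of_notMem (lab u) u v (hlab u) (huv ▸ hlab v)⟩

/-- Descending into the larger part of each union leads to a balanced cut whose first side
consists of `k` classes of vertices with the same neighbors on the second side. -/
theorem IsPartOf.exists_balanced_cut {e : SignedExpr V k} {G : SignedGraph V} (he : e.IsPartOf G)
    {X : Type*} [Finite X] {ι : X → V} (hι : Function.Injective ι) (hX : 2 ≤ Nat.card X)
    (hcard : Nat.card X ≤ 3 * (ι ⁻¹' e.verts).ncard) :
    ∃ (U : Set V) (lab : U → Fin k), (∀ u v, lab u = lab v → ∀ w ∉ U, ∀ s,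
        (G s).Adj u w → (G s).Adj v w) ∧
      Nat.card X ≤ 3 * (ι ⁻¹' U).ncard ∧ Nat.card X ≤ 3 * (ι ⁻¹' U)ᶜ.ncard := by
  have hsum (U : Set V) : (ι ⁻¹' U).ncard + (ι ⁻¹' U)ᶜ.ncard = Nat.card X :=
    Set.ncard_add_ncard_compl _
  induction e with
  | create v i =>
    have hle : (ι ⁻¹' (create v i).verts).ncard ≤ 1 :=
      Set.ncard_le_one_iff_subsingleton.2 fun x hx y hy => hι (Eq.trans hx (Eq.symm hy))
    have := hsum (create v i).verts
    obtain ⟨lab, hlab⟩ := he.exists_label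
    exact ⟨_, lab, hlab, hcard, by omega⟩
  | union e₁ e₂ ih₁ ih₂ =>
    by_cases h₁ : Nat.card X ≤ 3 * (ι ⁻¹' e₁.verts).ncard
    · exact ih₁ he.of_union_left h₁
    by_cases h₂ : Nat.card X ≤ 3 * (ι ⁻¹' e₂.verts).ncard
    · exact ih₂ he.union_comm.of_union_left h₂
    -- Both parts are below a third, so the union is below two thirds.
    have hle : (ι ⁻¹' (union e₁ e₂).verts).ncard ≤
        (ι ⁻¹' e₁.verts).ncard + (ι ⁻¹' e₂.verts).ncard := Set.ncard_union_le _ _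
    have := hsum (union e₁ e₂).verts
    obtain ⟨lab, hlab⟩ := he.exists_label
    exact ⟨_, lab, hlab, hcard, by omega⟩
  | join s i j hij e ih => exact ih he.of_join hcard
  | rename i j hij e ih => exact ih he.of_rename hcard

/-! ### Every finite signed graph has a construction sequence -/

theorem exists_edgeless (lab : V → Fin k) (s : Finset V) (hs : s.Nonempty) :
    ∃ e : SignedExpr V k, e.Valid ∧ e.verts = s ∧ (∀ v ∈ s, e.HasLabel v (lab v)) ∧
      ∀ t u v, ¬ e.Edge t u v := by
  classical
  induction hs using Finset.Nonempty.cons_induction with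
  | singleton v =>
    refine ⟨create v (lab v), True.intro, by simp [verts], fun u hu => ?_, fun _ _ _ h => h⟩
    obtain rfl := Finset.mem_singleton.1 hu
    exact ⟨rfl, rfl⟩
  | cons v s hv hs ih =>
    obtain ⟨e, he, hverts, hlab, hedge⟩ := ih
    refine ⟨union (create v (lab v)) e, ⟨True.intro, he, ?_⟩, ?_, fun u hu => ?_, ?_⟩
    · rw [hverts]
      exact Set.disjoint_singleton_left.2 hv
    · rw [verts, verts, hverts, Finset.coe_cons, Set.singleton_union]
    · rcases Finset.mem_cons.1 hu with rfl | hu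
      · exact Or.inl ⟨rfl, rfl⟩
      · exact Or.inr (hlab u hu)
    · rintro t a b (h | h)
      · exact h
      · exact hedge t a b h

/-- Give every vertex its own label and join edge by edge. This ensures that `cliquewidth` is
attained and is not the default `sInf ∅ = 0`. -/
theorem exists_constructs [Finite V] [Nonempty V] (G : SignedGraph V) :
    ∃ k, ∃ e : SignedExpr V k, e.Constructs G := by
  classical
  have := Fintype.ofFinite V
  let lab : V ≃ Fin (Fintype.card V) := Fintype.equivFin V
  suffices h : ∀ E : Finset (Bool × V × V), (∀ p ∈ E, (G p.1).Adj p.2.1 p.2.2) →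
      ∃ e : SignedExpr V (Fintype.card V), e.Valid ∧ e.verts = Set.univ ∧
        (∀ v, e.HasLabel v (lab v)) ∧ (∀ s u v, e.Edge s u v → (G s).Adj u v) ∧
        ∀ p ∈ E, e.Edge p.1 p.2.1 p.2.2 by
    obtain ⟨e, he, hverts, -, h₁, h₂⟩ :=
      h (Finset.univ.filter fun p => (G p.1).Adj p.2.1 p.2.2) (by simp)
    exact ⟨_, e, he, hverts, fun s u v => ⟨h₁ s u v, fun h => h₂ (s, u, v) (by simpa using h)⟩⟩
  intro E
  induction E using Finset.induction_on with
  | empty =>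
    obtain ⟨e, he, hverts, hlab, hedge⟩ := exists_edgeless lab Finset.univ Finset.univ_nonempty
    exact fun _ => ⟨e, he, by simpa using hverts, fun v => hlab v (Finset.mem_univ v),
      fun s u v h => absurd h (hedge s u v), by simp⟩
  | insert p E _ ih =>
    intro hE
    obtain ⟨e, he, hverts, hlab, h₁, h₂⟩ := ih fun q hq => hE q (Finset.mem_insert_of_mem hq)
    have hp := hE p (Finset.mem_insert_self p E)
    have heq : ∀ u v, e.HasLabel u (lab v) → u = v := fun u v h =>
      lab.injective (HasLabel.unique he (hlab u) h)
    refine ⟨join p.1 (lab p.2.1) (lab p.2.2) (lab.injective.ne hp.ne) e, he, hverts, hlab, ?_, ?_⟩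
    · rintro s u v (h | ⟨rfl, ⟨hu, hv⟩ | ⟨hu, hv⟩⟩)
      · exact h₁ s u v h
      · rw [heq _ _ hu, heq _ _ hv]
        exact hp
      · rw [heq _ _ hu, heq _ _ hv]
        exact hp.symm
    · intro q hq
      rcases Finset.mem_insert.1 hq with rfl | hq
      · exact Or.inr ⟨rfl, Or.inl ⟨hlab _, hlab _⟩⟩
      · exact Or.inl (h₂ q hq)

end SignedExpr

theorem CNFFormula.IsClausalEncoding.ccBest_le_scw {X Y : Type*} [Finite X] [Finite Y]
    {f : (X → Bool) → Bool} {F : CNFFormula (X ⊕ Y)} (hF : F.IsClausalEncoding f)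
    (hX : 2 ≤ Nat.card X) : ccBest f ≤ 3 * F.scw := by
  classical
  have : Nonempty X := (Nat.card_pos_iff.1 (by omega)).1
  obtain ⟨e, he⟩ : ∃ e : SignedExpr _ F.scw, e.Constructs F.signedIncidenceGraph :=
    Nat.sInf_mem (SignedExpr.exists_constructs F.signedIncidenceGraph)
  obtain ⟨U, lab, hlab, h₁, h₂⟩ := he.isPartOf.exists_balanced_cut
    (ι := fun x : X => Sum.inl (Sum.inl x)) (Sum.inl_injective.comp Sum.inl_injective) hX
    (by simp only [he.2.1, Set.preimage_univ, Set.ncard_univ]; omega)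
  let W : Set (PClause (X ⊕ Y)) := {c | ∃ h : c ∈ F, Sum.inr ⟨c, h⟩ ∈ U}
  -- Variables of `U` with equal labels occur with the same signs in each clause outside `U`, so two
  -- bits per label suffice. Clauses of `U` with equal labels have the same literals outside `U`, so
  -- `ψ` needs one.
  let φ (a : X ⊕ Y → Bool) (p : Fin F.scw × Bool) : Bool :=
    decide (∃ v, ∃ hv : Sum.inl v ∈ U, lab ⟨_, hv⟩ = p.1 ∧ a v = p.2)
  let ψ (b : X ⊕ Y → Bool) (i : Fin F.scw) : Bool :=
    decide (∃ c, ∃ hc : Sum.inr c ∈ U, lab ⟨_, hc⟩ = i ∧ c.1.SatisfiedOn (Sum.inl ⁻¹' U)ᶜ b)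
  have hcov := hF.hasRectangleCover_of_states (Sum.inl ⁻¹' U) W φ ψ (by
    rintro a b hab c hc hcW ⟨l, hl, hlU, hla⟩
    have h := decide_eq_decide.1 (congrFun hab (lab ⟨_, hlU⟩, l.2))
    obtain ⟨v, hv, hvl, hvb⟩ := h.1 ⟨l.1, hlU, rfl, hla⟩
    exact ⟨(v, l.2), hlab _ _ hvl.symm (Sum.inr ⟨c, hc⟩) (fun h => hcW ⟨hc, h⟩) l.2 hl, hv,
      hvb⟩) (by
    rintro a b hab c hc ⟨_, hcU⟩ hca
    have h := decide_eq_decide.1 (congrFun hab (lab ⟨_, hcU⟩))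
    obtain ⟨d, hd, hdl, l, hl, hlU, hlb⟩ := h.1 ⟨⟨c, hc⟩, hcU, rfl, hca⟩
    exact ⟨l, hlab ⟨_, hd⟩ ⟨_, hcU⟩ hdl (Sum.inl l.1) hlU l.2 hl, hlU, hlb⟩)
  have hcard : Nat.card (Fin F.scw × Bool → Bool) * Nat.card (Fin F.scw → Bool) =
      2 ^ (3 * F.scw) := by
    simp only [Nat.card_eq_fintype_card, Fintype.card_fun, Fintype.card_prod, Fintype.card_fin,
      Fintype.card_bool, ← pow_add]
    congr 1
    ring
  rw [hcard] at hcov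
  refine ((ccBest_le_nondetCC f h₁ h₂).trans (nondetCC_le_of_hasRectangleCover hcov)).trans ?_
  push_cast
  exact le_rfl

theorem mainTheorem3 :
    ∃ b : ℝ, 0 < b ∧
      ∀ (X : Type*) (Y : Type*) [Finite X] [Finite Y]
        (f : (X → Bool) → Bool) (C : CNFFormula (X ⊕ Y)),
        C.IsClausalEncoding f →
          b * ccBest f ≤ ((min (min C.twi C.twp) (min (max 1 C.twd) C.scw) : ℕ) : ℝ) := by
  -- The treewidth bounds have factor 4 and the cliquewidth bound factor 3.
  refine ⟨1 / 4, by norm_num, fun X Y _ _ f C hC => ?_⟩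
  by_cases hX : 2 ≤ Nat.card X
  · have h₁ := hC.ccBest_le_twi hX
    have h₂ := hC.ccBest_le_twp hX
    have h₃ := hC.ccBest_le_twd hX
    have h₄ := hC.ccBest_le_scw hX
    have h₅ : (0 : ℝ) ≤ C.scw := Nat.cast_nonneg _
    rw [Nat.cast_min, Nat.cast_min, Nat.cast_min]
    refine le_min (le_min ?_ ?_) (le_min ?_ ?_) <;> linarith
  · have h := ccBest_nonpos_of_card_le_one f (by omega)
    exact le_trans (by linarith) (Nat.cast_nonneg _)
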